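/- Let $\Phi\subset\mathbb{R}^2$ be a homogeneous Poisson point process (PPP) of density $\lambda\in[0,\infty)$, that is, a random locally finite set such that the number of points of $\Phi$ in any Borel set $A$ of finite area $|A|$ is Poisson distributed with mean $\lambda|A|$, and the numbers of points in pairwise disjoint such sets are independent. Let $(x_n)_{n<N}$, with $N\in\{0,1,2,\dots\}\cup\{\infty\}$ random, be a measurable enumeration of the points of $\Phi$ without repetition. Let $\alpha>0$ and let $\mathcal{X}_0,\mathcal{X}_1,\dots$ be i.i.d. random variables, jointly independent of $(N,(x_n))$, with $\mathcal{X}_n>0$ almost surely and $\mathbb{E}[\mathcal{X}_0^{2/\alpha}]<\infty$. Move each point $x_n$ of $\Phi$ to $y_n=\mathcal{X}_n^{-1/\alpha}x_n$. Then, almost surely, the points $y_n$, $n<N$, are pairwise distinct, and the point process $\Phi^{(e)}=\{y_n: n<N\}\subset\mathbb{R}^2$ is a homogeneous PPP of density $\lambda\,\mathbb{E}[\mathcal{X}_0^{2/\alpha}]$. -/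

import Mathlib

open MeasureTheory ProbabilityTheory
open scoped ENNReal

/-- The Euclidean plane `ℝ²`. -/
abbrev Plane : Type := EuclideanSpace ℝ (Fin 2)

/-- A random subset `Φ` of the plane is a homogeneous Poisson point process of density `lam`
(a finite number `≥ 0`) under `P`: it is almost surely locally finite, the number of its points in
a Borel set `A` of finite area `|A|` is Poisson distributed with mean `lam * |A|`, and the numbers
of points in finitely many pairwise disjoint Borel sets of finite area are independent.
Numbers of points are `ℕ∞`-valued. -/
structure IsHomogeneousPPP {Ω : Type*} [MeasurableSpace Ω] (P : Measure Ω)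
    (Φ : Ω → Set Plane) (lam : ℝ) : Prop where
  density_nonneg : 0 ≤ lam
  locallyFinite : ∀ᵐ ω ∂P, ∀ B : Set Plane, Bornology.IsBounded B → (Φ ω ∩ B).Finite
  hasLaw_count : ∀ A : Set Plane, MeasurableSet A → volume A ≠ ∞ →
    HasLaw (fun ω ↦ (Φ ω ∩ A).encard)
      ((poissonMeasure (lam * volume.real A).toNNReal).map (Nat.cast : ℕ → ℕ∞)) P
  indep_count : ∀ (m : ℕ) (A : Fin m → Set Plane), (∀ i, MeasurableSet (A i)) →
    (∀ i, volume (A i) ≠ ∞) → Pairwise (fun i j ↦ Disjoint (A i) (A j)) →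
    iIndepFun (fun i ω ↦ (Φ ω ∩ A i).encard) P

/-- The random set listed by the first `N` terms of the random sequence `x`
(`N` may be infinite). -/
def listedSet {Ω : Type*} (N : Ω → ℕ∞) (x : ℕ → Ω → Plane) (ω : Ω) : Set Plane :=
  {p | ∃ n : ℕ, (n : ℕ∞) < N ω ∧ x n ω = p}

/-- The first `N` terms of the random sequence `x` are distinct at `ω`. -/
def ListedDistinct {Ω : Type*} (N : Ω → ℕ∞) (x : ℕ → Ω → Plane) (ω : Ω) : Prop :=
  Set.InjOn (fun n : ℕ ↦ x n ω) {n : ℕ | (n : ℕ∞) < N ω}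

/-- The random set `Φ` is measurably enumerated by the first `N` terms of `x`: almost surely each
of its points is listed exactly once. -/
structure IsMeasurableEnumeration {Ω : Type*} [MeasurableSpace Ω] (P : Measure Ω)
    (Φ : Ω → Set Plane) (N : Ω → ℕ∞) (x : ℕ → Ω → Plane) : Prop where
  measurable_number : Measurable N
  measurable_point : ∀ n, Measurable (x n)
  distinct : ∀ᵐ ω ∂P, ListedDistinct N x ω
  eq_listedSet : ∀ᵐ ω ∂P, Φ ω = listedSet N x ω

/-- The marks `X 0, X 1, …` are i.i.d. real random variables, and the whole sequence of marks is
independent of the enumerated points. The mark of the point `x n` is `X n`. -/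
structure IsIIDMarking {Ω : Type*} [MeasurableSpace Ω] (P : Measure Ω)
    (N : Ω → ℕ∞) (x : ℕ → Ω → Plane) (X : ℕ → Ω → ℝ) : Prop where
  measurable_mark : ∀ n, Measurable (X n)
  indep : iIndepFun X P
  identDistrib : ∀ n, IdentDistrib (X n) (X 0) P P
  indep_points : IndepFun (fun ω n ↦ X n ω) (fun ω ↦ (N ω, fun n ↦ x n ω)) P

/-! The proof computes the Laplace functional `w ↦ E exp(-∑ w(y_n))` of the displaced points, for
measurable `w ≥ 0`, and recognises that of a Poisson process, `exp(-λ' ∫ (1 - e^{-w}))`. Given the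
points, the marks are still i.i.d., so each factor `e^{-w(y_n)}` may be averaged over its own mark.
This replaces `w` by `v` with `e^{-v(p)} = E e^{-w(X^{-1/α} p)}`
(`IsIIDMarking.lintegral_expNeg_tsum`). The functional of `Φ` at `v`
(`IsHomogeneousPPP.lintegral_expNeg`) has exponent `λ E ∫ (1 - e^{-w(X^{-1/α} p)}) dp` up to sign,
and a dilation of the plane turns the inner integral into `X^{2/α} ∫ (1 - e^{-w})`. Conversely, the
test functions `∑ a_i 1_{A_i}` recover the joint law of the counts
(`HasPoissonLaplaceFunctional.hasLaw_counts`). These counts run over indices, so coinciding points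
count separately. That no two coincide is then deduced from the Poisson counts on a fine grid
(`HasPoissonLaplaceFunctional.ae_listedDistinct`). All exponents live in `[0, ∞]` with `e^{-∞} = 0`,
so no sum needs to converge. -/

open Filter Topology

/-! ### The exponential `e^{-t}` on `[0, ∞]` -/

/-- The function `t ↦ exp (-t)` on `[0, ∞]`, with value `0` at `∞`. -/
noncomputable def expNeg (t : ℝ≥0∞) : ℝ≥0∞ := EReal.exp (-(t : EReal))

@[simp] lemma expNeg_zero : expNeg 0 = 1 := by simp [expNeg]

lemma expNeg_add (s t : ℝ≥0∞) : expNeg (s + t) = expNeg s * expNeg t := by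
  rw [expNeg, EReal.coe_ennreal_add, EReal.neg_add (by simp) (by simp), sub_eq_add_neg,
    EReal.exp_add, expNeg, expNeg]

lemma expNeg_sum {ι : Type*} (s : Finset ι) (f : ι → ℝ≥0∞) :
    expNeg (∑ i ∈ s, f i) = ∏ i ∈ s, expNeg (f i) := by
  classical
  induction s using Finset.induction_on with
  | empty => simp
  | insert i s hi ih => rw [Finset.sum_insert hi, Finset.prod_insert hi, expNeg_add, ih]

lemma expNeg_nat_mul (n : ℕ) (t : ℝ≥0∞) : expNeg (n * t) = expNeg t ^ n := by
  simpa using expNeg_sum (Finset.range n) (fun _ ↦ t)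

@[simp] lemma expNeg_le_one (t : ℝ≥0∞) : expNeg t ≤ 1 := by
  rw [expNeg, EReal.exp_le_one_iff, ← neg_zero, EReal.neg_le_neg_iff]
  exact EReal.coe_ennreal_nonneg t

lemma expNeg_ne_top (t : ℝ≥0∞) : expNeg t ≠ ∞ :=
  ne_top_of_le_ne_top ENNReal.one_ne_top (expNeg_le_one t)

lemma antitone_expNeg : Antitone expNeg := fun s t h ↦ by
  rw [expNeg, expNeg, EReal.exp_le_exp_iff, EReal.neg_le_neg_iff]
  exact_mod_cast h

lemma expNeg_injective : Function.Injective expNeg := fun s t h ↦ by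
  simpa using EReal.exp_strictMono.injective h

lemma expNeg_ofReal {t : ℝ} (ht : 0 ≤ t) :
    expNeg (ENNReal.ofReal t) = ENNReal.ofReal (Real.exp (-t)) := by
  rw [expNeg, EReal.coe_ennreal_ofReal, max_eq_left ht, ← EReal.coe_neg, EReal.exp_coe]

@[fun_prop] lemma continuous_expNeg : Continuous expNeg :=
  EReal.expHomeomorph.continuous.comp (continuous_neg.comp continuous_coe_ennreal_ereal)

@[fun_prop] lemma measurable_expNeg : Measurable expNeg := continuous_expNeg.measurable

/-- The inverse of `expNeg` on `[0, 1]`. -/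
noncomputable def negLog (u : ℝ≥0∞) : ℝ≥0∞ := (-ENNReal.log u).toENNReal

@[fun_prop] lemma measurable_negLog : Measurable negLog := by
  unfold negLog; fun_prop

lemma expNeg_negLog {u : ℝ≥0∞} (hu : u ≤ 1) : expNeg (negLog u) = u := by
  rw [expNeg, negLog, EReal.coe_toENNReal, neg_neg, ENNReal.exp_log]
  simpa using hu

/-! ### The Poisson law and uniqueness of Laplace transforms -/

/-- The Laplace transform of a Poisson distribution. -/
lemma lintegral_expNeg_poissonMeasure (r : NNReal) (a : ℝ≥0∞) :
    ∫⁻ k : ℕ∞, expNeg (a * k) ∂((poissonMeasure r).map (Nat.cast : ℕ → ℕ∞)) =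
      expNeg (r * (1 - expNeg a)) := by
  -- Here `s = e^{-a}`, so the transform is the generating function of the Poisson law at `s`. For
  -- `a = ∞` this is `s = 0`, and `0 ^ 0 = 1` agrees with `∞ * 0 = 0`.
  obtain ⟨s, hs0, hs1, hs⟩ : ∃ s : ℝ, 0 ≤ s ∧ s ≤ 1 ∧ expNeg a = ENNReal.ofReal s :=
    ⟨(expNeg a).toReal, ENNReal.toReal_nonneg,
      ENNReal.toReal_le_of_le_ofReal zero_le_one (by simp),
      (ENNReal.ofReal_toReal (expNeg_ne_top a)).symm⟩
  have hsum : HasSum (fun n : ℕ ↦ Real.exp (-r) * r ^ n / n.factorial * s ^ n)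
      (Real.exp (-(r * (1 - s)))) := by
    convert! (NormedSpace.expSeries_div_hasSum_exp (r * s : ℝ)).mul_left (Real.exp (-r)) using 1
    · ext n; rw [mul_pow]; ring
    · rw [← Real.exp_eq_exp_ℝ, ← Real.exp_add]; ring_nf
  rw [lintegral_map .of_discrete .of_discrete, poissonMeasure, lintegral_sum_measure]
  simp only [lintegral_smul_measure, lintegral_dirac, smul_eq_mul]
  have h1 : ∀ n : ℕ, ENNReal.ofReal (Real.exp (-r) * r ^ n / n.factorial) *
      expNeg (a * ((n : ℕ∞) : ℝ≥0∞)) =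
      ENNReal.ofReal (Real.exp (-r) * r ^ n / n.factorial * s ^ n) := fun n ↦ by
    rw [ENNReal.ofReal_mul (by positivity), mul_comm a, ENat.toENNReal_coe, expNeg_nat_mul, hs,
      ENNReal.ofReal_pow hs0]
  simp_rw [h1]
  rw [← ENNReal.ofReal_tsum_of_nonneg (fun n ↦ by positivity) hsum.summable, hsum.tsum_eq, hs,
    ← ENNReal.ofReal_one, ← ENNReal.ofReal_sub _ hs0, ← ENNReal.ofReal_coe_nnreal,
    ← ENNReal.ofReal_mul r.coe_nonneg, expNeg_ofReal (mul_nonneg r.coe_nonneg (by linarith))]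

/-- From `e^{-r} ≥ 1 - r` one gets `1 - e^{-r}(1 + r) ≤ 1 - (1 - r)(1 + r) = r²`. The quadratic
order is what rules out coincidences on a fine grid. -/
lemma poissonMeasure_two_le (r : NNReal) :
    ((poissonMeasure r).map (Nat.cast : ℕ → ℕ∞)) {k | 2 ≤ k} ≤ (r : ℝ≥0∞) ^ 2 := by
  rw [Measure.map_apply .of_discrete .of_discrete]
  have h : (Nat.cast : ℕ → ℕ∞) ⁻¹' {k | 2 ≤ k} = (({0, 1} : Finset ℕ) : Set ℕ)ᶜ := by
    ext n
    simp only [Set.mem_preimage, Set.mem_ofPred_eq, Finset.coe_insert, Finset.coe_singleton,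
      Set.mem_compl_iff, Set.mem_insert_iff, Set.mem_singleton_iff]
    rw [show (2 : ℕ∞) = ((2 : ℕ) : ℕ∞) from rfl, Nat.cast_le]
    omega
  rw [h, ← ENNReal.ofReal_toReal (measure_ne_top _ _), ← measureReal_def,
    probReal_compl_eq_one_sub (Finset.measurableSet _), ← sum_measureReal_singleton,
    Finset.sum_pair zero_ne_one, poissonMeasure_real_singleton, poissonMeasure_real_singleton,
    ← ENNReal.ofReal_coe_nnreal, ← ENNReal.ofReal_pow r.coe_nonneg]
  refine ENNReal.ofReal_le_ofReal ?_
  have h1 := Real.add_one_le_exp (-(r : ℝ))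
  have hr := r.coe_nonneg
  simp
  nlinarith

/-- The Laplace transform at integer arguments determines a law on `ℕ∞`-valued vectors. -/
lemma measure_ext_of_lintegral_expNeg {ι : Type*} [Fintype ι] (ν₁ ν₂ : Measure (ι → ℕ∞))
    [IsProbabilityMeasure ν₁] [IsProbabilityMeasure ν₂]
    (h : ∀ a : ι → ℕ, ∫⁻ k, expNeg (∑ i, a i * (k i : ℝ≥0∞)) ∂ν₁ =
      ∫⁻ k, expNeg (∑ i, a i * (k i : ℝ≥0∞)) ∂ν₂) : ν₁ = ν₂ := by
  classical
  -- The injection `k ↦ e^{-k}`, with `∞ ↦ 0`, carries the problem to a compact cube, where Laplace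
  -- transforms at integer arguments become moments and polynomials separate measures.
  let u : ℕ∞ → unitInterval := fun k ↦ ⟨(expNeg k).toReal, ENNReal.toReal_nonneg,
    ENNReal.toReal_le_of_le_ofReal zero_le_one (by simp)⟩
  have hu : Function.Injective u := fun k l hkl ↦ by
    have : (expNeg k).toReal = (expNeg l).toReal :=
      congrArg (fun z : unitInterval ↦ (z : ℝ)) hkl
    rw [ENNReal.toReal_eq_toReal_iff' (expNeg_ne_top _) (expNeg_ne_top _)] at this
    simpa using expNeg_injective this
  let U : (ι → ℕ∞) → (ι → unitInterval) := fun k i ↦ u (k i)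
  have hU : MeasurableEmbedding U :=
    ⟨fun k l hkl ↦ funext fun i ↦ hu (congrFun hkl i), .of_discrete,
      fun s _ ↦ (s.to_countable.image U).measurableSet⟩
  suffices ν₁.map U = ν₂.map U by
    rw [← hU.comap_map ν₁, this, hU.comap_map]
  have := Measure.isProbabilityMeasure_map (μ := ν₁) hU.measurable.aemeasurable
  have := Measure.isProbabilityMeasure_map (μ := ν₂) hU.measurable.aemeasurable
  let c : ι → BoundedContinuousFunction (ι → unitInterval) ℝ := fun i ↦
    BoundedContinuousFunction.mkOfCompact ⟨fun x ↦ (x i : ℝ), by fun_prop⟩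
  let A : StarSubalgebra ℝ (BoundedContinuousFunction (ι → unitInterval) ℝ) :=
    { (MvPolynomial.aeval c).range with
      star_mem' := fun {g} hg ↦ by
        have : star g = g := by ext; simp
        rwa [this] }
  have hmon : ∀ (ν : Measure (ι → ℕ∞)) [IsProbabilityMeasure ν] (a : ι → ℕ),
      ∫ x, ∏ i, (x i : ℝ) ^ a i ∂(ν.map U) =
        (∫⁻ k, expNeg (∑ i, a i * (k i : ℝ≥0∞)) ∂ν).toReal := fun ν _ a ↦ by
    rw [hU.integral_map, ← integral_toReal]
    · congr 1 with k
      simp [expNeg_sum, expNeg_nat_mul, U, u, ENNReal.toReal_prod]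
    · exact Measurable.of_discrete.aemeasurable
    · exact .of_forall fun _ ↦ (expNeg_ne_top _).lt_top
  refine ext_of_forall_mem_subalgebra_integral_eq_of_polish (𝕜 := ℝ) (A := A) ?_ ?_
  · intro x y hxy
    obtain ⟨i, hi⟩ := Function.ne_iff.1 hxy
    refine ⟨fun x ↦ (x i : ℝ), ⟨_, ⟨c i, ⟨MvPolynomial.X i, by simp⟩, rfl⟩, ?_⟩, ?_⟩
    · ext; rfl
    · simpa [Subtype.ext_iff] using hi
  · rintro g ⟨p, rfl⟩
    have hint : ∀ (g : BoundedContinuousFunction (ι → unitInterval) ℝ)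
      (ν : Measure (ι → unitInterval)) [IsProbabilityMeasure ν], Integrable g ν :=
      fun g ν _ ↦ g.integrable ν
    induction p using MvPolynomial.induction_on' with
    | monomial a r =>
      have : ∀ x, (MvPolynomial.aeval c (MvPolynomial.monomial a r)) x =
          r * ∏ i, (x i : ℝ) ^ a i := fun x ↦ by
        rw [MvPolynomial.aeval_monomial, Finsupp.prod_fintype _ _ (by simp)]
        simp [c, Algebra.algebraMap_eq_smul_one]
      simp [this, integral_const_mul, hmon, h]
    | add p q hp hq =>
      simp only [map_add, AlgHom.toRingHom_eq_coe, RingHom.coe_coe,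
        BoundedContinuousFunction.coe_add, Pi.add_apply] at hp hq ⊢
      rw [integral_add (hint _ _) (hint _ _), integral_add (hint _ _) (hint _ _), hp, hq]

/-! ### Counting measures of enumerated points -/

section ListedMeasure

variable {Ω E : Type*} [MeasurableSpace E]

open Classical in
/-- The counting measure of the points listed by the first `N` terms of `x`, with multiplicity. -/
noncomputable def listedMeasure (N : Ω → ℕ∞) (x : ℕ → Ω → E) (ω : Ω) : Measure E :=
  Measure.sum fun n : ℕ ↦ if (n : ℕ∞) < N ω then Measure.dirac (x n ω) else 0

/-- The number of indices `n < N` with `x n ∈ A`. -/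
noncomputable def listedCount (N : Ω → ℕ∞) (x : ℕ → Ω → E) (A : Set E) (ω : Ω) : ℕ∞ :=
  {n : ℕ | (n : ℕ∞) < N ω ∧ x n ω ∈ A}.encard

variable {N : Ω → ℕ∞} {x : ℕ → Ω → E}

open Classical in
lemma lintegral_listedMeasure {v : E → ℝ≥0∞} (hv : Measurable v) (ω : Ω) :
    ∫⁻ p, v p ∂listedMeasure N x ω = ∑' n : ℕ, if (n : ℕ∞) < N ω then v (x n ω) else 0 := by
  rw [listedMeasure, lintegral_sum_measure]
  congr 1 with n
  split_ifs <;> simp [lintegral_dirac' _ hv]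

lemma listedMeasure_apply {A : Set E} (hA : MeasurableSet A) (ω : Ω) :
    listedMeasure N x ω A = listedCount N x A ω := by
  classical
  rw [← lintegral_indicator_one hA, lintegral_listedMeasure (measurable_one.indicator hA),
    listedCount, ← ENNReal.tsum_set_one, tsum_subtype _ (fun _ ↦ (1 : ℝ≥0∞))]
  congr 1 with n
  simp only [Set.indicator_apply, Set.mem_ofPred_eq, ite_and, Pi.one_apply]

variable [MeasurableSpace Ω]

lemma measurable_lintegral_listedMeasure (hN : Measurable N) (hx : ∀ n, Measurable (x n))
    {v : E → ℝ≥0∞} (hv : Measurable v) :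
    Measurable fun ω ↦ ∫⁻ p, v p ∂listedMeasure N x ω := by
  classical
  simp_rw [lintegral_listedMeasure hv]
  exact Measurable.tsum fun n ↦ Measurable.ite (hN (.of_discrete (s := {k | (n : ℕ∞) < k})))
    (hv.comp (hx n)) measurable_const

lemma measurable_listedCount (hN : Measurable N) (hx : ∀ n, Measurable (x n))
    {A : Set E} (hA : MeasurableSet A) : Measurable (listedCount N x A) := by
  have h := measurable_lintegral_listedMeasure hN hx (measurable_one.indicator hA)
  simp_rw [lintegral_indicator_one hA, listedMeasure_apply hA] at h
  -- `ℕ∞` is countable, so it suffices to measure the fibres, which are fibres of the `[0,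
  -- ∞]`-valued count.
  refine measurable_to_countable' fun k ↦ ?_
  have : listedCount N x A ⁻¹' {k} =
      (fun ω ↦ (listedCount N x A ω : ℝ≥0∞)) ⁻¹' {(k : ℝ≥0∞)} := by
    ext; simp
  rw [this]
  exact h (measurableSet_singleton _)

end ListedMeasure

lemma encard_listedSet_inter {Ω : Type*} {N : Ω → ℕ∞} {x : ℕ → Ω → Plane} {ω : Ω}
    (h : ListedDistinct N x ω) (A : Set Plane) :
    (listedSet N x ω ∩ A).encard = listedCount N x A ω := by
  have : listedSet N x ω ∩ A =
      (fun n : ℕ ↦ x n ω) '' {n : ℕ | (n : ℕ∞) < N ω ∧ x n ω ∈ A} := by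
    ext p
    constructor
    · rintro ⟨⟨n, hn, rfl⟩, hp⟩
      exact ⟨n, ⟨hn, hp⟩, rfl⟩
    · rintro ⟨n, ⟨hn, hp⟩, rfl⟩
      exact ⟨⟨n, hn, rfl⟩, hp⟩
  rw [this, listedCount, Set.InjOn.encard_image]
  exact Set.InjOn.mono (fun n hn ↦ hn.1) h

/-! ### The Laplace functional of a Poisson process -/

section Poisson

variable {Ω : Type*} [MeasurableSpace Ω] {P : Measure Ω} {Φ : Ω → Set Plane}
  {lam : ℝ} {N : Ω → ℕ∞} {x : ℕ → Ω → Plane}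

lemma IsMeasurableEnumeration.encard_inter_ae_eq (hx : IsMeasurableEnumeration P Φ N x) :
    ∀ᵐ ω ∂P, ∀ A : Set Plane, (Φ ω ∩ A).encard = listedCount N x A ω := by
  filter_upwards [hx.distinct, hx.eq_listedSet] with ω h1 h2 A
  rw [h2, encard_listedSet_inter h1]

/-- Independence of the counts factors the expectation, and each factor is a Poisson Laplace
transform. -/
lemma IsHomogeneousPPP.lintegral_expNeg_sum (hΦ : IsHomogeneousPPP P Φ lam)
    (hx : IsMeasurableEnumeration P Φ N x) {m : ℕ} {A : Fin m → Set Plane}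
    (hA : ∀ i, MeasurableSet (A i)) (hfin : ∀ i, volume (A i) ≠ ∞)
    (hdisj : Pairwise (fun i j ↦ Disjoint (A i) (A j))) (a : Fin m → ℝ≥0∞) :
    ∫⁻ ω, expNeg (∑ i, a i * listedMeasure N x ω (A i)) ∂P =
      expNeg (ENNReal.ofReal lam * ∑ i, (1 - expNeg (a i)) * volume (A i)) := by
  have h1 : ∫⁻ ω, expNeg (∑ i, a i * listedMeasure N x ω (A i)) ∂P =
      ∫⁻ ω, ∏ i, expNeg (a i * listedCount N x (A i) ω) ∂P := by
    simp_rw [expNeg_sum, fun ω i ↦ listedMeasure_apply (N := N) (x := x) (hA i) ω]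
  have hlaw : ∀ i, HasLaw (listedCount N x (A i))
      ((poissonMeasure (lam * volume.real (A i)).toNNReal).map (Nat.cast : ℕ → ℕ∞)) P := fun i ↦
    (hΦ.hasLaw_count _ (hA i) (hfin i)).congr <| by
      filter_upwards [hx.encard_inter_ae_eq] with ω h using (h _).symm
  have hind : iIndepFun (fun i ↦ listedCount N x (A i)) P := by
    refine (hΦ.indep_count m A hA hfin hdisj).congr fun i ↦ ?_
    filter_upwards [hx.encard_inter_ae_eq] with ω h using h _
  have hmeas : ∀ i, Measurable fun k : ℕ∞ ↦ expNeg (a i * (k : ℝ≥0∞)) := fun i ↦ .of_discrete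
  rw [h1, lintegral_prod_eq_prod_lintegral_of_indepFun _
    (fun i ω ↦ expNeg (a i * listedCount N x (A i) ω)) (hind.comp _ hmeas)
    (fun i ↦ (hmeas i).comp (measurable_listedCount hx.1 hx.2 (hA i))), Finset.mul_sum,
    expNeg_sum]
  refine Finset.prod_congr rfl fun i _ ↦ ?_
  rw [(hlaw i).lintegral_comp (f := fun k : ℕ∞ ↦ expNeg (a i * (k : ℝ≥0∞)))
    (hmeas i).aemeasurable, lintegral_expNeg_poissonMeasure]
  congr 1
  rw [← ENNReal.ofReal, ENNReal.ofReal_mul hΦ.density_nonneg, measureReal_def,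
    ENNReal.ofReal_toReal (hfin i), mul_assoc, mul_comm (volume (A i))]

lemma IsHomogeneousPPP.lintegral_expNeg_simpleFunc (hΦ : IsHomogeneousPPP P Φ lam)
    (hx : IsMeasurableEnumeration P Φ N x) (s : SimpleFunc Plane ℝ≥0∞)
    (hs : ∀ c ≠ 0, volume (s ⁻¹' {c}) ≠ ∞) :
    ∫⁻ ω, expNeg (∫⁻ p, s p ∂listedMeasure N x ω) ∂P =
      expNeg (ENNReal.ofReal lam * ∫⁻ p, (1 - expNeg (s p))) := by
  classical
  -- The fibre over `0` may have infinite area. It is dropped because it contributes nothing to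
  -- either integral; the other fibres are disjoint and have finite area.
  set R := s.range.erase 0 with hR
  have hsum : ∀ (μ : Measure Plane) (g : ℝ≥0∞ → ℝ≥0∞), g 0 = 0 →
      ∫⁻ p, g (s p) ∂μ = ∑ i : Fin R.card,
        g (R.equivFin.symm i) * μ (s ⁻¹' {(R.equivFin.symm i : ℝ≥0∞)}) := fun μ g hg ↦ by
    have h1 : ∫⁻ p, g (s p) ∂μ = (s.map g).lintegral μ :=
      (SimpleFunc.lintegral_eq_lintegral (s.map g) μ)
    rw [h1, SimpleFunc.map_lintegral, R.equivFin.symm.sum_comp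
      (fun c : R ↦ g c * μ (s ⁻¹' {(c : ℝ≥0∞)})),
      Finset.sum_coe_sort R (fun c ↦ g c * μ (s ⁻¹' {c})), hR]
    refine (Finset.sum_erase _ ?_).symm
    simp [hg]
  rw [hsum volume (fun c ↦ 1 - expNeg c) (by simp)]
  simp_rw [hsum _ (fun c ↦ c) rfl]
  refine hΦ.lintegral_expNeg_sum hx (fun i ↦ s.measurableSet_fiber _)
    (fun i ↦ hs _ (Finset.ne_of_mem_erase (R.equivFin.symm i).2)) (fun i j hij ↦ ?_) _
  refine Disjoint.preimage _ (Set.disjoint_singleton.2 fun h ↦ hij ?_)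
  exact R.equivFin.symm.injective (Subtype.ext h)

variable [IsProbabilityMeasure P]

/-- The Laplace functional of a Poisson point process. -/
theorem IsHomogeneousPPP.lintegral_expNeg (hΦ : IsHomogeneousPPP P Φ lam)
    (hx : IsMeasurableEnumeration P Φ N x) {v : Plane → ℝ≥0∞} (hv : Measurable v) :
    ∫⁻ ω, expNeg (∫⁻ p, v p ∂listedMeasure N x ω) ∂P =
      expNeg (ENNReal.ofReal lam * ∫⁻ p, (1 - expNeg (v p))) := by
  -- Cutting off to balls gives the nonzero fibres finite area and keeps the approximation
  -- increasing to `v`.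
  let s : ℕ → SimpleFunc Plane ℝ≥0∞ := fun k ↦
    (SimpleFunc.eapprox v k).restrict (Metric.ball 0 k)
  have hs : ∀ k p, s k p = (Metric.ball 0 (k : ℝ)).indicator (SimpleFunc.eapprox v k) p :=
    fun k p ↦ SimpleFunc.restrict_apply _ measurableSet_ball p
  have hmono : ∀ p, Monotone fun k ↦ s k p := fun p k l hkl ↦ by
    simp only [hs]
    have hball : Metric.ball (0 : Plane) (k : ℝ) ⊆ Metric.ball 0 (l : ℝ) :=
      Metric.ball_subset_ball (by exact_mod_cast hkl)
    exact (Set.indicator_le_indicator_of_subset hball (fun _ ↦ zero_le) p).trans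
      (Set.indicator_le_indicator (SimpleFunc.monotone_eapprox v hkl p))
  have hlim : ∀ p, Tendsto (fun k ↦ s k p) atTop (𝓝 (v p)) := fun p ↦ by
    have h1 : Tendsto (fun k ↦ SimpleFunc.eapprox v k p) atTop (𝓝 (v p)) := by
      rw [← SimpleFunc.iSup_eapprox_apply hv]
      exact tendsto_atTop_iSup fun k l hkl ↦ SimpleFunc.monotone_eapprox v hkl p
    refine h1.congr' ?_
    obtain ⟨k₀, hk₀⟩ := exists_nat_gt ‖p‖
    filter_upwards [eventually_ge_atTop k₀] with k hk
    rw [hs, Set.indicator_of_mem]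
    rw [mem_ball_zero_iff]
    exact hk₀.trans_le (by exact_mod_cast hk)
  have hfib : ∀ k, ∀ c ≠ 0, volume (s k ⁻¹' {c}) ≠ ∞ := fun k c hc ↦ by
    refine ne_top_of_le_ne_top (measure_ball_lt_top (μ := volume) (x := (0 : Plane)) (r := k)).ne
      (measure_mono fun p hp ↦ ?_)
    by_contra h
    have : s k p = c := hp
    rw [hs, Set.indicator_of_notMem h] at this
    exact hc this.symm
  have hleft : Tendsto (fun k ↦ ∫⁻ ω, expNeg (∫⁻ p, s k p ∂listedMeasure N x ω) ∂P) atTop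
      (𝓝 (∫⁻ ω, expNeg (∫⁻ p, v p ∂listedMeasure N x ω) ∂P)) := by
    refine tendsto_lintegral_of_dominated_convergence (fun _ ↦ 1) (fun k ↦ ?_) (fun k ↦ ?_)
      (by simp) (.of_forall fun ω ↦ ?_)
    · exact measurable_expNeg.comp
        (measurable_lintegral_listedMeasure hx.1 hx.2 (s k).measurable)
    · exact .of_forall fun ω ↦ expNeg_le_one _
    · exact (continuous_expNeg.tendsto _).comp <| lintegral_tendsto_of_tendsto_of_monotone
        (fun k ↦ (s k).measurable.aemeasurable) (.of_forall hmono) (.of_forall hlim)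
  have hright : Tendsto (fun k ↦ expNeg (ENNReal.ofReal lam * ∫⁻ p, (1 - expNeg (s k p)))) atTop
      (𝓝 (expNeg (ENNReal.ofReal lam * ∫⁻ p, (1 - expNeg (v p))))) := by
    refine (continuous_expNeg.tendsto _).comp (ENNReal.Tendsto.const_mul ?_
      (.inr ENNReal.ofReal_ne_top))
    refine lintegral_tendsto_of_tendsto_of_monotone (fun k ↦ ?_) (.of_forall fun p k l hkl ↦ ?_)
      (.of_forall fun p ↦ ?_)
    · exact (measurable_const.sub (measurable_expNeg.comp (s k).measurable)).aemeasurable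
    · exact tsub_le_tsub_left (antitone_expNeg (hmono p hkl)) 1
    · exact ENNReal.Tendsto.sub tendsto_const_nhds ((continuous_expNeg.tendsto _).comp (hlim p))
        (.inl ENNReal.one_ne_top)
  refine tendsto_nhds_unique hleft (hright.congr fun k ↦ ?_)
  exact (hΦ.lintegral_expNeg_simpleFunc hx (s k) (hfib k)).symm

end Poisson

/-! ### Averaging over independent marks -/

section Marks

lemma lintegral_prod_comp_of_iIndepFun {Ω S : Type*} [MeasurableSpace Ω] [MeasurableSpace S]
    {P : Measure Ω} {X : ℕ → Ω → S} (hX : iIndepFun X P) (hXm : ∀ n, Measurable (X n))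
    {g : ℕ → S → ℝ≥0∞} (hg : ∀ n, Measurable (g n)) (s : Finset ℕ) :
    ∫⁻ ω, ∏ n ∈ s, g n (X n ω) ∂P = ∏ n ∈ s, ∫⁻ ω, g n (X n ω) ∂P :=
  lintegral_prod_eq_prod_lintegral_of_indepFun s (fun n ω ↦ g n (X n ω)) (hX.comp g hg)
    fun n ↦ (hg n).comp (hXm n)

/-- Fubini's theorem for a product over independent variables that are jointly independent of
a further variable `Z`. -/
lemma lintegral_prod_comp_of_indepFun {Ω S T : Type*} [MeasurableSpace Ω] [MeasurableSpace S]
    [MeasurableSpace T] {P : Measure Ω} [IsProbabilityMeasure P] {X : ℕ → Ω → S} {Z : Ω → T}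
    (hX : iIndepFun X P) (hXm : ∀ n, Measurable (X n)) (hZ : Measurable Z)
    (hXZ : IndepFun (fun ω n ↦ X n ω) Z P) {G : ℕ → S → T → ℝ≥0∞}
    (hG : ∀ n, Measurable (Function.uncurry (G n))) (s : Finset ℕ) :
    ∫⁻ ω, ∏ n ∈ s, G n (X n ω) (Z ω) ∂P =
      ∫⁻ ω, ∏ n ∈ s, ∫⁻ m, G n m (Z ω) ∂(P.map (X n)) ∂P := by
  have hY : Measurable fun ω n ↦ X n ω := measurable_pi_lambda _ hXm
  have : IsProbabilityMeasure (P.map fun ω n ↦ X n ω) :=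
    Measure.isProbabilityMeasure_map hY.aemeasurable
  have : IsProbabilityMeasure (P.map Z) := Measure.isProbabilityMeasure_map hZ.aemeasurable
  have : ∀ n, IsProbabilityMeasure (P.map (X n)) := fun n ↦
    Measure.isProbabilityMeasure_map (hXm n).aemeasurable
  have hGz : ∀ n z, Measurable fun m ↦ G n m z := fun n z ↦
    (hG n).comp measurable_prodMk_right
  have hprod : Measurable fun q : (ℕ → S) × T ↦ ∏ n ∈ s, G n (q.1 n) q.2 :=
    Finset.measurable_prod _ fun n _ ↦ by
      have h : Measurable fun q : (ℕ → S) × T ↦ (q.1 n, q.2) :=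
        ((measurable_pi_apply n).comp measurable_fst).prodMk measurable_snd
      exact (hG n).comp h
  have hinner : ∀ z, ∫⁻ y, ∏ n ∈ s, G n (y n) z ∂(P.map fun ω n ↦ X n ω) =
      ∏ n ∈ s, ∫⁻ m, G n m z ∂(P.map (X n)) := fun z ↦ by
    have hz : Measurable fun y : ℕ → S ↦ ∏ n ∈ s, G n (y n) z :=
      hprod.comp measurable_prodMk_right
    rw [lintegral_map hz hY, lintegral_prod_comp_of_iIndepFun hX hXm (fun n ↦ hGz n z)]
    exact Finset.prod_congr rfl fun n _ ↦ (lintegral_map (hGz n z) (hXm n)).symm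
  calc _ = ∫⁻ q, ∏ n ∈ s, G n (q.1 n) q.2 ∂(P.map fun ω ↦ (fun n ↦ X n ω, Z ω)) :=
        (lintegral_map hprod (hY.prodMk hZ)).symm
    _ = ∫⁻ z, ∏ n ∈ s, ∫⁻ m, G n m z ∂(P.map (X n)) ∂(P.map Z) := by
        rw [(indepFun_iff_map_prod_eq_prod_map_map hY.aemeasurable hZ.aemeasurable).1 hXZ,
          lintegral_prod_symm' _ hprod]
        exact lintegral_congr hinner
    _ = _ := lintegral_map (Finset.measurable_prod _ fun n _ ↦ (hG n).lintegral_prod_left) hZ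

variable {Ω : Type*} [MeasurableSpace Ω] {P : Measure Ω} [IsProbabilityMeasure P]
  {N : Ω → ℕ∞} {x : ℕ → Ω → Plane} {X : ℕ → Ω → ℝ}

open Classical in
-- With `N` and the points frozen, the product splits over the marks. An index `n ≥ N` contributes
-- the factor `1` on both sides, so a random number of points causes no difficulty.
lemma IsIIDMarking.lintegral_expNeg_sum_range (hX : IsIIDMarking P N x X) (hN : Measurable N)
    (hx : ∀ n, Measurable (x n)) {V : Plane → ℝ → ℝ≥0∞} (hV : Measurable (Function.uncurry V))
    {v : Plane → ℝ≥0∞}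
    (hVv : ∀ p, ∫⁻ m, expNeg (V p m) ∂(P.map (X 0)) = expNeg (v p)) (M : ℕ) :
    ∫⁻ ω, expNeg (∑ n ∈ Finset.range M, if (n : ℕ∞) < N ω then V (x n ω) (X n ω) else 0) ∂P =
      ∫⁻ ω, expNeg (∑ n ∈ Finset.range M, if (n : ℕ∞) < N ω then v (x n ω) else 0) ∂P := by
  have hμ : IsProbabilityMeasure (P.map (X 0)) :=
    Measure.isProbabilityMeasure_map (hX.measurable_mark 0).aemeasurable
  have hlt : ∀ n : ℕ, MeasurableSet {z : ℕ∞ × (ℕ → Plane) | (n : ℕ∞) < z.1} := fun n ↦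
    measurable_fst (.of_discrete (s := {k : ℕ∞ | (n : ℕ∞) < k}))
  have hpt : ∀ n, Measurable fun z : ℕ∞ × (ℕ → Plane) ↦ z.2 n := fun n ↦
    (measurable_pi_apply n).comp measurable_snd
  have hG : ∀ n : ℕ, Measurable fun q : ℝ × (ℕ∞ × (ℕ → Plane)) ↦
      expNeg (if (n : ℕ∞) < q.2.1 then V (q.2.2 n) q.1 else 0) := fun n ↦
    measurable_expNeg.comp <| Measurable.ite (measurable_snd (hlt n))
      (hV.comp (((hpt n).comp measurable_snd).prodMk measurable_fst)) measurable_const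
  simp_rw [expNeg_sum]
  rw [lintegral_prod_comp_of_indepFun hX.indep hX.measurable_mark
    (hN.prodMk (measurable_pi_lambda _ hx)) hX.indep_points
    (G := fun n m z ↦ expNeg (if (n : ℕ∞) < z.1 then V (z.2 n) m else 0)) hG]
  refine lintegral_congr fun ω ↦ Finset.prod_congr rfl fun n _ ↦ ?_
  rw [(hX.identDistrib n).map_eq]
  dsimp only
  split_ifs with h
  · exact hVv _
  · simp

lemma tendsto_lintegral_expNeg_sum_range {f : ℕ → Ω → ℝ≥0∞} (hf : ∀ n, Measurable (f n)) :
    Tendsto (fun M ↦ ∫⁻ ω, expNeg (∑ n ∈ Finset.range M, f n ω) ∂P) atTop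
      (𝓝 (∫⁻ ω, expNeg (∑' n, f n ω) ∂P)) := by
  refine tendsto_lintegral_of_dominated_convergence (fun _ ↦ 1) (fun M ↦ ?_)
    (fun M ↦ .of_forall fun ω ↦ expNeg_le_one _) (by simp) (.of_forall fun ω ↦ ?_)
  · exact measurable_expNeg.comp (Finset.measurable_sum _ fun n _ ↦ hf n)
  · exact (continuous_expNeg.tendsto _).comp (ENNReal.tendsto_nat_tsum _)

/-- Independent marks are averaged out in the Laplace functional of a marked process. -/
lemma IsIIDMarking.lintegral_expNeg_tsum (hX : IsIIDMarking P N x X) (hN : Measurable N)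
    (hx : ∀ n, Measurable (x n)) {τ : ℝ → Plane → Plane}
    (hτ : Measurable (Function.uncurry τ)) {w : Plane → ℝ≥0∞} (hw : Measurable w) :
    ∫⁻ ω, expNeg (∫⁻ p, w p ∂listedMeasure N (fun n ω ↦ τ (X n ω) (x n ω)) ω) ∂P =
      ∫⁻ ω, expNeg (∫⁻ p, negLog (∫⁻ m, expNeg (w (τ m p)) ∂(P.map (X 0)))
        ∂listedMeasure N x ω) ∂P := by
  classical
  have hμ : IsProbabilityMeasure (P.map (X 0)) :=
    Measure.isProbabilityMeasure_map (hX.measurable_mark 0).aemeasurable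
  have hV : Measurable (Function.uncurry fun p m ↦ w (τ m p)) :=
    hw.comp (hτ.comp measurable_swap)
  have hv : Measurable fun p ↦ negLog (∫⁻ m, expNeg (w (τ m p)) ∂(P.map (X 0))) :=
    measurable_negLog.comp (measurable_expNeg.comp hV).lintegral_prod_right'
  have hVv : ∀ p, ∫⁻ m, expNeg (w (τ m p)) ∂(P.map (X 0)) =
      expNeg (negLog (∫⁻ m, expNeg (w (τ m p)) ∂(P.map (X 0)))) := fun p ↦
    (expNeg_negLog ((lintegral_mono fun m ↦ expNeg_le_one _).trans (by simp))).symm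
  have hlt : ∀ n : ℕ, MeasurableSet {ω | (n : ℕ∞) < N ω} := fun n ↦
    hN (.of_discrete (s := {k : ℕ∞ | (n : ℕ∞) < k}))
  simp_rw [lintegral_listedMeasure hw, lintegral_listedMeasure hv]
  -- Both sides are limits of the truncated expectations, which agree for every number of terms.
  refine tendsto_nhds_unique (tendsto_lintegral_expNeg_sum_range fun n ↦
    Measurable.ite (hlt n) (hw.comp (hτ.comp ((hX.measurable_mark n).prodMk (hx n))))
      measurable_const) ?_
  simp_rw [hX.lintegral_expNeg_sum_range hN hx hV hVv]
  exact tendsto_lintegral_expNeg_sum_range fun n ↦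
    Measurable.ite (hlt n) (hv.comp (hx n)) measurable_const

end Marks

/-! ### The Laplace functional of the displaced points -/

/-- The Laplace functional of the points listed by the first `N` terms of `y`, with multiplicity,
is that of a Poisson process of density `lam`. -/
def HasPoissonLaplaceFunctional {Ω : Type*} [MeasurableSpace Ω] (P : Measure Ω) (N : Ω → ℕ∞)
    (y : ℕ → Ω → Plane) (lam : ℝ) : Prop :=
  ∀ w : Plane → ℝ≥0∞, Measurable w →
    ∫⁻ ω, expNeg (∫⁻ p, w p ∂listedMeasure N y ω) ∂P =
      expNeg (ENNReal.ofReal lam * ∫⁻ p, (1 - expNeg (w p)))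

lemma lintegral_one_sub {Ω : Type*} [MeasurableSpace Ω] (μ : Measure Ω) [IsProbabilityMeasure μ]
    {f : Ω → ℝ≥0∞} (hf : Measurable f) (h1 : ∀ ω, f ω ≤ 1) :
    ∫⁻ ω, (1 - f ω) ∂μ = 1 - ∫⁻ ω, f ω ∂μ := by
  have h : ∫⁻ ω, f ω ∂μ ≤ 1 := (lintegral_mono h1).trans (by simp)
  rw [lintegral_sub hf (ne_top_of_le_ne_top ENNReal.one_ne_top h) (.of_forall h1)]
  simp

lemma lintegral_comp_smul_plane {g : Plane → ℝ≥0∞} (hg : Measurable g) {c : ℝ} (hc : c ≠ 0) :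
    ∫⁻ p, g (c • p) = ENNReal.ofReal |(c ^ 2)⁻¹| * ∫⁻ p, g p := by
  have := Measure.map_addHaar_smul (volume : Measure Plane) hc
  rw [← lintegral_map hg (measurable_const_smul c), this, lintegral_smul_measure, smul_eq_mul]
  simp

theorem IsHomogeneousPPP.hasPoissonLaplaceFunctional_smul {Ω : Type*} [MeasurableSpace Ω]
    {P : Measure Ω} [IsProbabilityMeasure P] {Φ : Ω → Set Plane} {lam : ℝ}
    (hΦ : IsHomogeneousPPP P Φ lam) {N : Ω → ℕ∞} {x : ℕ → Ω → Plane}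
    (hx : IsMeasurableEnumeration P Φ N x) {X : ℕ → Ω → ℝ} (hX : IsIIDMarking P N x X)
    (hpos : ∀ᵐ ω ∂P, 0 < X 0 ω) {α : ℝ}
    (hint : Integrable (fun ω ↦ X 0 ω ^ (2 / α)) P) :
    HasPoissonLaplaceFunctional P N (fun n ω ↦ X n ω ^ (-(1 / α)) • x n ω)
      (lam * ∫ ω, X 0 ω ^ (2 / α) ∂P) := by
  intro w hw
  set μ := P.map (X 0) with hμ
  have : IsProbabilityMeasure μ :=
    Measure.isProbabilityMeasure_map (hX.measurable_mark 0).aemeasurable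
  have hτ : Measurable (Function.uncurry fun (m : ℝ) (p : Plane) ↦ m ^ (-(1 / α)) • p) := by
    unfold Function.uncurry; fun_prop
  have hjoint : Measurable fun q : Plane × ℝ ↦ expNeg (w (q.2 ^ (-(1 / α)) • q.1)) :=
    measurable_expNeg.comp (hw.comp (hτ.comp measurable_swap))
  have hmean : Measurable fun p : Plane ↦ ∫⁻ m, expNeg (w (m ^ (-(1 / α)) • p)) ∂μ :=
    hjoint.lintegral_prod_right
  have hmean_le : ∀ p : Plane, ∫⁻ m, expNeg (w (m ^ (-(1 / α)) • p)) ∂μ ≤ 1 := fun p ↦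
    (lintegral_mono fun m ↦ expNeg_le_one _).trans (by simp)
  rw [hX.lintegral_expNeg_tsum (τ := fun m p ↦ m ^ (-(1 / α)) • p) hx.1 hx.2 hτ hw,
    hΦ.lintegral_expNeg hx (v := fun p ↦ negLog (∫⁻ m, expNeg (w (m ^ (-(1 / α)) • p)) ∂μ))
      (measurable_negLog.comp hmean)]
  congr 1
  have h1 : ∀ p : Plane, 1 - expNeg (negLog (∫⁻ m, expNeg (w (m ^ (-(1 / α)) • p)) ∂μ)) =
      ∫⁻ m, (1 - expNeg (w (m ^ (-(1 / α)) • p))) ∂μ := fun p ↦ by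
    rw [expNeg_negLog (hmean_le p)]
    exact (lintegral_one_sub μ (hjoint.comp measurable_prodMk_left) fun m ↦ expNeg_le_one _).symm
  -- A dilation by `c = m^{-1/α}` scales plane integrals by `c^{-2} = m^{2/α}`. This needs `m > 0`,
  -- which holds for almost every mark.
  have h2 : ∀ᵐ m ∂μ, ∫⁻ p : Plane, (1 - expNeg (w (m ^ (-(1 / α)) • p))) =
      ENNReal.ofReal (m ^ (2 / α)) * ∫⁻ p, (1 - expNeg (w p)) := by
    have hm : ∀ᵐ m ∂μ, 0 < m :=
      (ae_map_iff (hX.measurable_mark 0).aemeasurable measurableSet_Ioi).2 hpos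
    filter_upwards [hm] with m hm
    rw [lintegral_comp_smul_plane (g := fun p ↦ 1 - expNeg (w p)) (by fun_prop)
      (Real.rpow_pos_of_pos hm _).ne', abs_of_pos (by positivity), ← Real.rpow_natCast,
      ← Real.rpow_mul hm.le, ← Real.rpow_neg hm.le]
    congr 3
    push_cast
    ring
  have h3 : ∫⁻ m, ENNReal.ofReal (m ^ (2 / α)) ∂μ =
      ENNReal.ofReal (∫ ω, X 0 ω ^ (2 / α) ∂P) := by
    rw [ofReal_integral_eq_lintegral_ofReal hint
      (hpos.mono fun ω h ↦ Real.rpow_nonneg h.le _), hμ,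
      lintegral_map (by fun_prop) (hX.measurable_mark 0)]
  simp_rw [h1]
  -- Tonelli puts the plane integral inside, where the dilation formula applies mark by mark.
  rw [lintegral_lintegral_swap (measurable_const.sub hjoint).aemeasurable, lintegral_congr_ae h2,
    lintegral_mul_const _ (by fun_prop), h3, ENNReal.ofReal_mul hΦ.density_nonneg, mul_assoc]

/-! ### From the Laplace functional back to a Poisson process -/

section PoissonLaplace

variable {Ω : Type*} [MeasurableSpace Ω] {P : Measure Ω}
  {N : Ω → ℕ∞} {y : ℕ → Ω → Plane} {lam : ℝ}

/-- By disjointness at most one indicator is nonzero at `p`, and `1 - e^{-0} = 0` elsewhere. -/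
lemma one_sub_expNeg_sum_indicator {E ι : Type*} [Fintype ι] {A : ι → Set E}
    (hdisj : Pairwise (fun i j ↦ Disjoint (A i) (A j))) (a : ι → ℝ≥0∞) (p : E) :
    1 - expNeg (∑ i, (A i).indicator (fun _ ↦ a i) p) =
      ∑ i, (A i).indicator (fun _ ↦ 1 - expNeg (a i)) p := by
  by_cases h : ∃ i, p ∈ A i
  · obtain ⟨i, hi⟩ := h
    have hj : ∀ j ≠ i, p ∉ A j := fun j hji hj ↦ Set.disjoint_left.1 (hdisj hji) hj hi
    rw [Finset.sum_eq_single i (by simp +contextual [hj]) (by simp),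
      Finset.sum_eq_single i (by simp +contextual [hj]) (by simp)]
    simp [hi]
  · push Not at h
    simp [h]

/-- The test function `∑ a_i 1_{A_i}` yields the joint Laplace transform of the counts. It factors
into Poisson transforms, which gives the marginals and their independence at once. -/
lemma HasPoissonLaplaceFunctional.hasLaw_counts [IsProbabilityMeasure P]
    (h : HasPoissonLaplaceFunctional P N y lam)
    (hlam : 0 ≤ lam) (hN : Measurable N) (hy : ∀ n, Measurable (y n)) {ι : Type*} [Fintype ι]
    {A : ι → Set Plane} (hA : ∀ i, MeasurableSet (A i)) (hfin : ∀ i, volume (A i) ≠ ∞)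
    (hdisj : Pairwise (fun i j ↦ Disjoint (A i) (A j))) :
    HasLaw (fun ω i ↦ listedCount N y (A i) ω) (Measure.pi fun i ↦
      (poissonMeasure (lam * volume.real (A i)).toNNReal).map (Nat.cast : ℕ → ℕ∞)) P := by
  have hmeas : Measurable fun ω i ↦ listedCount N y (A i) ω :=
    measurable_pi_lambda _ fun i ↦ measurable_listedCount hN hy (hA i)
  have : IsProbabilityMeasure (P.map fun ω i ↦ listedCount N y (A i) ω) :=
    Measure.isProbabilityMeasure_map hmeas.aemeasurable
  refine ⟨hmeas.aemeasurable, measure_ext_of_lintegral_expNeg _ _ fun a ↦ ?_⟩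
  rw [lintegral_map .of_discrete hmeas]
  have hw : Measurable fun p ↦ ∑ i, (A i).indicator (fun _ ↦ (a i : ℝ≥0∞)) p :=
    Finset.measurable_sum _ fun i _ ↦ measurable_const.indicator (hA i)
  have hleft : ∀ ω, ∑ i, (a i : ℝ≥0∞) * listedCount N y (A i) ω =
      ∫⁻ p, ∑ i, (A i).indicator (fun _ ↦ (a i : ℝ≥0∞)) p ∂listedMeasure N y ω := fun ω ↦ by
    rw [lintegral_finsetSum _ fun i _ ↦ measurable_const.indicator (hA i)]
    simp_rw [fun i ↦ lintegral_indicator_const (μ := listedMeasure N y ω) (hA i) (a i : ℝ≥0∞),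
      fun i ↦ listedMeasure_apply (N := N) (x := y) (hA i) ω]
  simp_rw [hleft]
  rw [h _ hw]
  simp_rw [one_sub_expNeg_sum_indicator hdisj, expNeg_sum]
  rw [lintegral_finsetSum _ fun i _ ↦ measurable_const.indicator (hA i), Finset.mul_sum,
    expNeg_sum]
  have hind := iIndepFun_pi (μ := fun i ↦
    (poissonMeasure (lam * volume.real (A i)).toNNReal).map (Nat.cast : ℕ → ℕ∞))
    (X := fun i k ↦ expNeg (a i * (k : ℝ≥0∞))) fun i ↦ Measurable.of_discrete.aemeasurable
  rw [lintegral_prod_eq_prod_lintegral_of_indepFun _ _ hind fun i ↦ .of_discrete]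
  refine Finset.prod_congr rfl fun i _ ↦ ?_
  have hi := (measurePreserving_eval (fun i ↦
    (poissonMeasure (lam * volume.real (A i)).toNNReal).map (Nat.cast : ℕ → ℕ∞)) i).lintegral_comp
    (f := fun k : ℕ∞ ↦ expNeg (a i * (k : ℝ≥0∞))) .of_discrete
  refine Eq.trans ?_ hi.symm
  rw [lintegral_expNeg_poissonMeasure,
    lintegral_indicator_const (hA i)]
  congr 1
  rw [← ENNReal.ofReal, ENNReal.ofReal_mul hlam, measureReal_def,
    ENNReal.ofReal_toReal (hfin i), mul_assoc, mul_comm (volume (A i))]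

lemma HasPoissonLaplaceFunctional.hasLaw_count [IsProbabilityMeasure P]
    (h : HasPoissonLaplaceFunctional P N y lam)
    (hlam : 0 ≤ lam) (hN : Measurable N) (hy : ∀ n, Measurable (y n))
    {A : Set Plane} (hA : MeasurableSet A) (hfin : volume A ≠ ∞) :
    HasLaw (listedCount N y A)
      ((poissonMeasure (lam * volume.real A).toNNReal).map (Nat.cast : ℕ → ℕ∞)) P :=
  (measurePreserving_eval (fun _ : Fin 1 ↦
    (poissonMeasure (lam * volume.real A).toNNReal).map (Nat.cast : ℕ → ℕ∞)) 0).hasLaw.comp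
    (h.hasLaw_counts hlam hN hy (fun _ ↦ hA) (fun _ ↦ hfin) Subsingleton.pairwise)

/-- A Poisson variable is almost surely finite, and countably many balls of integer radius absorb
every bounded set, so one null set serves for all `B`. -/
lemma HasPoissonLaplaceFunctional.ae_count_ne_top [IsProbabilityMeasure P]
    (h : HasPoissonLaplaceFunctional P N y lam)
    (hlam : 0 ≤ lam) (hN : Measurable N) (hy : ∀ n, Measurable (y n)) :
    ∀ᵐ ω ∂P, ∀ B : Set Plane, Bornology.IsBounded B → listedCount N y B ω ≠ ⊤ := by
  have h1 : ∀ᵐ ω ∂P, ∀ k : ℕ, listedCount N y (Metric.ball 0 k) ω ≠ ⊤ := by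
    refine ae_all_iff.2 fun k ↦ ?_
    rw [(h.hasLaw_count hlam hN hy measurableSet_ball measure_ball_lt_top.ne).ae_iff
      (p := fun n ↦ n ≠ ⊤) (measurable_of_countable _),
      ae_map_iff Measurable.of_discrete.aemeasurable .of_discrete]
    exact .of_forall fun n ↦ ENat.natCast_ne_top n
  filter_upwards [h1] with ω hω B hB
  obtain ⟨r, hr⟩ := hB.subset_ball 0
  obtain ⟨k, hk⟩ := exists_nat_ge r
  refine ne_top_of_le_ne_top (hω k) (Set.encard_le_encard fun n hn ↦ ⟨hn.1, ?_⟩)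
  exact Metric.ball_subset_ball hk (hr hn.2)

/-- The grid cell of mesh `1 / k` that contains a point. -/
noncomputable def gridCell (k : ℕ) (p : Plane) : Fin 2 → ℤ := fun i ↦ ⌊k * p i⌋

lemma measurable_gridCell (k : ℕ) : Measurable (gridCell k) :=
  measurable_pi_lambda _ fun i ↦ Int.measurable_floor.comp
    (by fun_prop : Measurable fun p : Plane ↦ (k : ℝ) * p i)

lemma volume_gridCell_le {k : ℕ} (hk : 0 < k) (c : Fin 2 → ℤ) :
    volume (gridCell k ⁻¹' {c}) ≤ ENNReal.ofReal (1 / k) := by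
  have hk' : (0 : ℝ) < k := by exact_mod_cast hk
  have hk1 : (1 : ℝ) ≤ k := by exact_mod_cast hk
  calc volume (gridCell k ⁻¹' {c})
      ≤ volume ((WithLp.ofLp : Plane → Fin 2 → ℝ) ⁻¹'
          (Set.univ.pi fun i ↦ Set.Ico (c i / k : ℝ) ((c i + 1) / k))) := by
        refine measure_mono fun p hp i _ ↦ ?_
        have := Int.floor_eq_iff.1 (congrFun hp i)
        rw [Set.mem_Ico, div_le_iff₀' hk', lt_div_iff₀' hk']
        exact this
    _ = ENNReal.ofReal (1 / k) ^ 2 := by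
        rw [(PiLp.volume_preserving_ofLp (Fin 2)).measure_preimage
          (MeasurableSet.univ_pi fun i ↦ measurableSet_Ico).nullMeasurableSet, Real.volume_pi_Ico]
        simp [← sub_div]
    _ ≤ ENNReal.ofReal (1 / k) := by
        -- The cell has area `1 / k²`; the cruder bound `1 / k` already tends to zero.
        refine pow_le_of_le_one (zero_le) ?_ two_ne_zero
        rw [ENNReal.ofReal_le_one, div_le_one hk']
        exact hk1

lemma HasPoissonLaplaceFunctional.measure_two_le_count_le [IsProbabilityMeasure P]
    (h : HasPoissonLaplaceFunctional P N y lam)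
    (hlam : 0 ≤ lam) (hN : Measurable N) (hy : ∀ n, Measurable (y n))
    {A : Set Plane} (hA : MeasurableSet A) (hfin : volume A ≠ ∞) :
    P {ω | 2 ≤ listedCount N y A ω} ≤ (ENNReal.ofReal lam * volume A) ^ 2 := by
  rw [(h.hasLaw_count hlam hN hy hA hfin).measure_eq (p := fun n ↦ 2 ≤ n) .of_discrete]
  refine (poissonMeasure_two_le _).trans_eq ?_
  rw [← ENNReal.ofReal, ENNReal.ofReal_mul hlam, measureReal_def, ENNReal.ofReal_toReal hfin]

lemma two_le_listedCount {Ω E : Type*} {N : Ω → ℕ∞} {y : ℕ → Ω → E} {A : Set E} {ω : Ω} {n m : ℕ}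
    (hnm : n ≠ m) (hn : (n : ℕ∞) < N ω) (hm : (m : ℕ∞) < N ω) (hnA : y n ω ∈ A)
    (hmA : y m ω ∈ A) : 2 ≤ listedCount N y A ω := by
  rw [← Set.encard_pair hnm]
  refine Set.encard_le_encard ?_
  rintro l (rfl | rfl)
  exacts [⟨hn, hnA⟩, ⟨hm, hmA⟩]

/-- Coinciding points share a grid cell, whose count is then at least two. The union bound gives `λ²
∑ |C|²`, and `|C| ≤ 1 / k` for one factor leaves `∑ |C| = |B|` for the other. -/
lemma HasPoissonLaplaceFunctional.measure_collision_le [IsProbabilityMeasure P]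
    (h : HasPoissonLaplaceFunctional P N y lam)
    (hlam : 0 ≤ lam) (hN : Measurable N) (hy : ∀ n, Measurable (y n))
    {B : Set Plane} (hB : MeasurableSet B) (hfin : volume B ≠ ∞) {k : ℕ} (hk : 0 < k) :
    P {ω | ∃ n m : ℕ, n ≠ m ∧ (n : ℕ∞) < N ω ∧ (m : ℕ∞) < N ω ∧ y n ω = y m ω ∧ y n ω ∈ B} ≤
      ENNReal.ofReal lam ^ 2 * volume B * ENNReal.ofReal (1 / k) := by
  let C : (Fin 2 → ℤ) → Set Plane := fun c ↦ B ∩ gridCell k ⁻¹' {c}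
  have hcell : ∀ c, MeasurableSet (gridCell k ⁻¹' {c}) := fun c ↦
    measurable_gridCell k (measurableSet_singleton c)
  have hCB : ∀ c, volume (C c) ≤ volume B := fun c ↦ measure_mono Set.inter_subset_left
  have hsum : ∑' c, volume (C c) = volume B := by
    rw [← measure_iUnion (fun c d hcd ↦ ?_) fun c ↦ hB.inter (hcell c), ← Set.inter_iUnion]
    · congr 1
      refine Set.inter_eq_left.2 fun p _ ↦ Set.mem_iUnion.2 ⟨gridCell k p, rfl⟩
    · exact ((Set.disjoint_singleton.2 hcd).preimage _).mono Set.inter_subset_right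
        Set.inter_subset_right
  calc _ ≤ P (⋃ c, {ω | 2 ≤ listedCount N y (C c) ω}) := by
        refine measure_mono ?_
        rintro ω ⟨n, m, hnm, hn, hm, heq, hnB⟩
        exact Set.mem_iUnion.2 ⟨gridCell k (y n ω), two_le_listedCount hnm hn hm ⟨hnB, rfl⟩
          (heq ▸ ⟨hnB, rfl⟩)⟩
    _ ≤ ∑' c, P {ω | 2 ≤ listedCount N y (C c) ω} := measure_iUnion_le _
    _ ≤ ∑' c, ENNReal.ofReal lam ^ 2 * ENNReal.ofReal (1 / k) * volume (C c) := by
        refine ENNReal.tsum_le_tsum fun c ↦ (h.measure_two_le_count_le hlam hN hy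
          (hB.inter (hcell c)) (ne_top_of_le_ne_top hfin (hCB c))).trans ?_
        rw [mul_pow, mul_assoc, sq (volume _)]
        gcongr
        exact (measure_mono Set.inter_subset_right).trans (volume_gridCell_le hk c)
    _ = _ := by rw [ENNReal.tsum_mul_left, hsum]; ring

/-- Within a fixed ball the collision probability is below a bound that vanishes as the mesh `1 / k`
tends to zero; balls of integer radius exhaust the plane. -/
lemma HasPoissonLaplaceFunctional.ae_listedDistinct [IsProbabilityMeasure P]
    (h : HasPoissonLaplaceFunctional P N y lam)
    (hlam : 0 ≤ lam) (hN : Measurable N) (hy : ∀ n, Measurable (y n)) :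
    ∀ᵐ ω ∂P, ListedDistinct N y ω := by
  let S : ℕ → Set Ω := fun r ↦ {ω | ∃ n m : ℕ, n ≠ m ∧ (n : ℕ∞) < N ω ∧ (m : ℕ∞) < N ω ∧
    y n ω = y m ω ∧ y n ω ∈ Metric.ball 0 (r : ℝ)}
  have hS : ∀ r, P (S r) = 0 := fun r ↦ by
    have hlim : Tendsto (fun k : ℕ ↦ ENNReal.ofReal lam ^ 2 *
        volume (Metric.ball (0 : Plane) (r : ℝ)) * ENNReal.ofReal (1 / k)) atTop (𝓝 0) := by
      have h0 := ENNReal.tendsto_ofReal tendsto_one_div_atTop_nhds_zero_nat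
      rw [ENNReal.ofReal_zero] at h0
      have := ENNReal.Tendsto.const_mul h0 (a := ENNReal.ofReal lam ^ 2 *
        volume (Metric.ball (0 : Plane) (r : ℝ)))
        (.inr (ENNReal.mul_ne_top (by simp) measure_ball_lt_top.ne))
      rwa [mul_zero] at this
    refine le_antisymm (ge_of_tendsto hlim ?_) zero_le
    filter_upwards [eventually_gt_atTop 0] with k hk
    exact h.measure_collision_le hlam hN hy measurableSet_ball measure_ball_lt_top.ne hk
  have hS' : ∀ᵐ ω ∂P, ∀ r, ω ∉ S r := ae_all_iff.2 fun r ↦ measure_eq_zero_iff_ae_notMem.1 (hS r)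
  filter_upwards [hS'] with ω hω n hn m hm hnm
  by_contra hne
  obtain ⟨r, hr⟩ := exists_nat_gt ‖y n ω‖
  exact hω r ⟨n, m, hne, hn, hm, hnm, mem_ball_zero_iff.2 hr⟩

/-- The points of a process with Poisson Laplace functional form a Poisson point process. -/
theorem HasPoissonLaplaceFunctional.isHomogeneousPPP [IsProbabilityMeasure P]
    (h : HasPoissonLaplaceFunctional P N y lam)
    (hlam : 0 ≤ lam) (hN : Measurable N) (hy : ∀ n, Measurable (y n)) :
    IsHomogeneousPPP P (listedSet N y) lam := by
  have hcount : ∀ᵐ ω ∂P, ∀ A, (listedSet N y ω ∩ A).encard = listedCount N y A ω :=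
    (h.ae_listedDistinct hlam hN hy).mono fun ω hω ↦ encard_listedSet_inter hω
  refine ⟨hlam, ?_, fun A hA hfin ↦ ?_, fun m A hA hfin hdisj ↦ ?_⟩
  · filter_upwards [hcount, h.ae_count_ne_top hlam hN hy] with ω h1 h2 B hB
    rw [← Set.encard_ne_top_iff, h1]
    exact h2 B hB
  · exact (h.hasLaw_count hlam hN hy hA hfin).congr (hcount.mono fun ω hω ↦ hω A)
  · have hind : iIndepFun (fun i ↦ listedCount N y (A i)) P :=
      (iIndepFun_iff_hasLaw_pi_pi fun i ↦ h.hasLaw_count hlam hN hy (hA i) (hfin i)).2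
        (h.hasLaw_counts hlam hN hy hA hfin hdisj)
    exact hind.congr fun i ↦ hcount.mono fun ω hω ↦ (hω (A i)).symm

end PoissonLaplace

theorem lemma1 {Ω : Type*} [MeasurableSpace Ω] (P : Measure Ω) [IsProbabilityMeasure P]
    (Φ : Ω → Set Plane) (lam : ℝ) (hΦ : IsHomogeneousPPP P Φ lam)
    (N : Ω → ℕ∞) (x : ℕ → Ω → Plane) (hx : IsMeasurableEnumeration P Φ N x)
    (X : ℕ → Ω → ℝ) (hX : IsIIDMarking P N x X) (hpos : ∀ᵐ ω ∂P, 0 < X 0 ω)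
    (α : ℝ) (hα : 0 < α) (hint : Integrable (fun ω ↦ X 0 ω ^ (2 / α)) P) :
    (∀ᵐ ω ∂P, ListedDistinct N (fun n ω ↦ X n ω ^ (-(1 / α)) • x n ω) ω) ∧
      IsHomogeneousPPP P (listedSet N (fun n ω ↦ X n ω ^ (-(1 / α)) • x n ω))
        (lam * ∫ ω, X 0 ω ^ (2 / α) ∂P) := by
  have h := hΦ.hasPoissonLaplaceFunctional_smul hx hX hpos hint
  have hlam : 0 ≤ lam * ∫ ω, X 0 ω ^ (2 / α) ∂P := mul_nonneg hΦ.density_nonneg <|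
    integral_nonneg_of_ae (hpos.mono fun ω hω ↦ Real.rpow_nonneg hω.le _)
  have hy : ∀ n, Measurable fun ω ↦ X n ω ^ (-(1 / α)) • x n ω := fun n ↦
    ((hX.measurable_mark n).pow_const _).smul (hx.measurable_point n)
  exact ⟨h.ae_listedDistinct hlam hx.measurable_number hy,
    h.isHomogeneousPPP hlam hx.measurable_number hy⟩
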